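/- **Conventions.** A *type* is a sequence $\tau=\langle m_k,n_{k+1},r_{k+1}\rangle_{k\in\omega}$ of natural numbers with $m_0=1$, $n_{k+1}\ge 2$, $m_k>r_{k+1}$ and $m_{k+1}=r_{k+1}+(m_k-r_{k+1})n_{k+1}$ for all $k$; it is *good* if every $r\in\omega$ equals $r_{k+1}$ for infinitely many $k$. For sets of ordinals, $A<B$ means that every element of $A$ is smaller than every element of $B$. A *construction scheme* (over $\omega_1$, of good type $\tau$) is a family $\mathcal F$ of non-empty finite subsets of $\omega_1$ that is cofinal in the non-empty finite subsets of $\omega_1$ under inclusion, each of whose members has cardinality $m_k$ for some $k$, and such that, for $\mathcal F_k=\{F\in\mathcal F:|F|=m_k\}$: (i) if $E,F\in\mathcal F_k$ then $E\cap F$ is an initial segment of both $E$ and $F$; (ii) each $F\in\mathcal F_{k+1}$ is a union $F=\bigcup_{i<n_{k+1}}F_i$ of members of $\mathcal F_k$ which form a $\Delta$-system with a root $R(F)$ such that $|R(F)|=r_{k+1}$ and $R(F)<F_0\setminus R(F)<\dots<F_{n_{k+1}-1}\setminus R(F)$. For $\alpha,\beta\in\omega_1$ let $\rho(\alpha,\beta)=\min\{k:\exists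 F\in\mathcal F_k\ (\alpha,\beta\in F)\}$, $\|\alpha\|_k=|\{\xi<\alpha:\rho(\alpha,\xi)\le k\}|$ and $\Delta(\alpha,\beta)=\min\{k:\|\alpha\|_k\ne\|\beta\|_k\}$ ($=\omega$ if there is no such $k$). Let $\Xi_\alpha(0)=0$ and, for $k\ge 1$ and any $F\in\mathcal F_k$ with $\alpha\in F$, let $\Xi_\alpha(k)=-1$ if $\alpha\in R(F)$ and $\Xi_\alpha(k)=i$ if $\alpha\in F_i\setminus R(F)$. Let $\mathcal D=\langle D_i\rangle_{i<n}$ be a $\Delta$-system of distinct finite subsets of $\omega_1$ of the same size $m\ge 1$ with root $R$, such that $R<D_i\setminus R$ for all $i$ and, for $i\neq j$, $D_i\setminus R<D_j\setminus R$ or conversely. Write $D_i(a)$ for the $a$-th element of $D_i$ ($a<m$) and $r=|R|$. Then $\mathcal D$ is *captured at level $l$* if $\Xi_{D_i(a)}(l)=-1$ for $a<r$, $\Xi_{D_i(a)}(l)=i$ for $r\le a<m$, and $\rho(D_i(a),D_j(a))=l=\Delta(D_i(a),D_j(a))$ for all $i<j<n$ and $r\le a<m$. A scheme $\mathcal F$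 is *$n$-capturing* if for every uncountable family $\mathcal S$ of non-empty finite subsets of $\omega_1$ there are infinitely many $l$ for which some $n$-element subfamily of $\mathcal S$, suitably enumerated, is captured at level $l$. For a (non-empty) forcing notion $\mathbb P$, $\mathfrak m(\mathbb P)$ is the least cardinal $\kappa$ such that some family of $\kappa$ dense subsets of $\mathbb P$ is not met by any single filter ($\infty$ if there is none). If $\mathcal F$ is a $2$-capturing construction scheme, $\mathfrak m_{\mathcal F}$ is the minimum of $\mathfrak m(\mathbb P)$ over all ccc forcing notions $\mathbb P$ such that $\mathbb P\Vdash$ "$\mathcal F$ is $2$-capturing"; if $\mathcal F$ is not $2$-capturing, $\mathfrak m_{\mathcal F}=\omega$. A *tree* is a partial order in which the set of predecessors of every element is well-ordered; an *$\omega_1$-tree* is a tree of height $\omega_1$ with countable levels. An *Aronszajn tree* is an $\omega_1$-tree without uncountable chains; a *Suslin tree* is an $\omega_1$-tree with neither uncountable chains nor uncountable antichains (sets of pairwise incomparable elements). A tree is *special* if it can be partitioned into countably many antichains. **Theorem.** Let $\mathcal F$ be a $2$-capturing construction scheme of good type. If $\mathfrak m_{\mathcal F}>\omega_1$, then 1.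 there are no Suslin trees, and 2. every Aronszajn tree is special. -/

import Mathlib

open scoped Cardinal Ordinal

universe u v w

noncomputable section

/-! ### Construction schemes over the first uncountable ordinal -/

/-- The first uncountable ordinal, as a well-ordered type. -/
abbrev OmegaOne : Type u := (ω_ 1 : Ordinal.{u}).ToType

/-- The non-empty finite subsets of `ω₁`. -/
abbrev FinOmegaOne : Type u := {s : Finset OmegaOne.{u} // s.Nonempty}

/-- A type `⟨m_k, n_{k+1}, r_{k+1}⟩_{k ∈ ω}`. The values `n 0` and `r 0` play no role. -/
structure SchemeType where
  m : ℕ → ℕ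
  n : ℕ → ℕ
  r : ℕ → ℕ
  m_zero : m 0 = 1
  two_le_n : ∀ k, 2 ≤ n (k + 1)
  r_lt_m : ∀ k, r (k + 1) < m k
  m_succ : ∀ k, m (k + 1) = r (k + 1) + (m k - r (k + 1)) * n (k + 1)

/-- A type is good if every natural number occurs infinitely often among the `r_{k+1}`. -/
def SchemeType.IsGood (τ : SchemeType) : Prop :=
  ∀ s : ℕ, {k : ℕ | τ.r (k + 1) = s}.Infinite

/-- `A < B` for finite sets of ordinals (vacuous if one of them is empty). -/
def FinsetLT (A B : Finset OmegaOne.{u}) : Prop := ∀ a ∈ A, ∀ b ∈ B, a < b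

/-- `A` is an initial segment of `B`. -/
def IsInitialPart (A B : Finset OmegaOne.{u}) : Prop :=
  A ⊆ B ∧ ∀ a ∈ A, ∀ b ∈ B, b ≤ a → b ∈ A

/-- The `k`-th layer `F_k` of a family `F`: its members of cardinality `m_k`. -/
def layer (τ : SchemeType) (F : Set (Finset OmegaOne.{u})) (k : ℕ) : Set (Finset OmegaOne.{u}) :=
  {E | E ∈ F ∧ E.card = τ.m k}

/-- `G 0, …, G (n_{k+1} - 1)` is a decomposition of `E` into members of `F_k` that form a
`Δ`-system with root `R`, where `|R| = r_{k+1}` and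
`R < G 0 \ R < ⋯ < G (n_{k+1} - 1) \ R`. -/
structure IsDecomposition (τ : SchemeType) (F : Set (Finset OmegaOne.{u})) (k : ℕ)
    (E : Finset OmegaOne.{u}) (G : Fin (τ.n (k + 1)) → Finset OmegaOne.{u})
    (R : Finset OmegaOne.{u}) : Prop where
  mem_layer : ∀ i, G i ∈ layer τ F k
  mem_iff : ∀ x, x ∈ E ↔ ∃ i, x ∈ G i
  inter_eq : ∀ i j, i ≠ j → G i ∩ G j = R
  card_root : R.card = τ.r (k + 1)
  root_lt : ∀ i, FinsetLT R (G i \ R)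
  tail_lt : ∀ i j, i < j → FinsetLT (G i \ R) (G j \ R)

/-- `F` is a construction scheme of type `τ` over `ω₁`. -/
structure IsConstructionScheme (τ : SchemeType) (F : Set (Finset OmegaOne.{u})) : Prop where
  cofinal : ∀ A : Finset OmegaOne.{u}, A.Nonempty → ∃ E ∈ F, A ⊆ E
  card_mem : ∀ E ∈ F, ∃ k, E.card = τ.m k
  coherent : ∀ k, ∀ E ∈ layer τ F k, ∀ E' ∈ layer τ F k,
    IsInitialPart (E ∩ E') E ∧ IsInitialPart (E ∩ E') E'
  decomposes : ∀ k, ∀ E ∈ layer τ F (k + 1), ∃ G R, IsDecomposition τ F k E G R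

/-- The ordinal metric `ρ(α, β)`: the least `k` such that some member of `F_k` contains both
`α` and `β`. -/
def rho (τ : SchemeType) (F : Set (Finset OmegaOne.{u})) (a b : OmegaOne.{u}) : ℕ :=
  sInf {k : ℕ | ∃ E ∈ layer τ F k, a ∈ E ∧ b ∈ E}

/-- The `k`-cardinality `‖α‖_k`: the number of `ξ < α` with `ρ(α, ξ) ≤ k`. -/
def kCard (τ : SchemeType) (F : Set (Finset OmegaOne.{u})) (a : OmegaOne.{u}) (k : ℕ) : ℕ :=
  {x : OmegaOne.{u} | x < a ∧ rho τ F a x ≤ k}.ncard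

/-- `Δ(α, β)`: the least `k` with `‖α‖_k ≠ ‖β‖_k`, and `ω` if there is none. -/
def schemeDelta (τ : SchemeType) (F : Set (Finset OmegaOne.{u})) (a b : OmegaOne.{u}) : ℕ∞ :=
  sInf {l : ℕ∞ | ∃ k : ℕ, l = k ∧ kCard τ F a k ≠ kCard τ F b k}

/-- `z` is the value at `α` and `k + 1` read off from a member `E` of `F_{k+1}` with `α ∈ E`: it
is `-1` if `α` lies in the root of the decomposition of `E`, and `i` if `α` lies in the tail of
its `i`-th piece. -/
def IsXiValue (τ : SchemeType) (F : Set (Finset OmegaOne.{u})) (a : OmegaOne.{u}) (k : ℕ)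
    (z : ℤ) : Prop :=
  ∃ E ∈ layer τ F (k + 1), a ∈ E ∧ ∃ G R, IsDecomposition τ F k E G R ∧
    ((a ∈ R ∧ z = -1) ∨ ∃ i, a ∈ G i \ R ∧ z = ((i : ℕ) : ℤ))

open Classical in
/-- The function `Ξ_α : ω → {-1} ∪ ω`. For a construction scheme the value at `k + 1` exists and
does not depend on the member of `F_{k+1}` that is used. -/
def schemeXi (τ : SchemeType) (F : Set (Finset OmegaOne.{u})) (a : OmegaOne.{u}) : ℕ → ℤ
  | 0 => 0
  | k + 1 => if h : ∃ z, IsXiValue τ F a k z then h.choose else 0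

/-- The sequence `D 0, …, D (n - 1)` of distinct non-empty finite sets, all of the same size `m`,
is a root-tail-tail `Δ`-system with root `R`, and it is captured at level `l`. The element
number `a` of `D i` in increasing order is `(D i).orderEmbOfFin _ a`, and `r = |R|`. -/
def IsCapturedAt (τ : SchemeType) (F : Set (Finset OmegaOne.{u})) {n : ℕ}
    (D : Fin n → Finset OmegaOne.{u}) (l : ℕ) : Prop :=
  Function.Injective D ∧
  ∃ (m : ℕ) (hD : ∀ i, (D i).card = m) (R : Finset OmegaOne.{u}),
    1 ≤ m ∧
    (∀ i j, i ≠ j → D i ∩ D j = R) ∧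
    (∀ i, FinsetLT R (D i \ R)) ∧
    (∀ i j, i ≠ j → FinsetLT (D i \ R) (D j \ R) ∨ FinsetLT (D j \ R) (D i \ R)) ∧
    (∀ (i : Fin n) (a : Fin m),
      schemeXi τ F ((D i).orderEmbOfFin (hD i) a) l =
        if (a : ℕ) < R.card then -1 else ((i : ℕ) : ℤ)) ∧
    (∀ (i j : Fin n) (a : Fin m), i < j → R.card ≤ (a : ℕ) →
      rho τ F ((D i).orderEmbOfFin (hD i) a) ((D j).orderEmbOfFin (hD j) a) = l ∧
      schemeDelta τ F ((D i).orderEmbOfFin (hD i) a) ((D j).orderEmbOfFin (hD j) a) = l)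

/-- `F` is `n`-capturing: for every uncountable family `S` of non-empty finite subsets of `ω₁`
there are infinitely many `l` such that some `n`-element subfamily of `S` is captured at
level `l`. -/
def IsCapturing (τ : SchemeType) (F : Set (Finset OmegaOne.{u})) (n : ℕ) : Prop :=
  ∀ S : Set FinOmegaOne.{u}, ¬ S.Countable →
    ∀ k : ℕ, ∃ l : ℕ, k ≤ l ∧ ∃ D : Fin n → FinOmegaOne.{u},
      IsCapturedAt τ F (fun i => (D i : Finset OmegaOne.{u})) l ∧ ∀ i, D i ∈ S

/-! ### Forcing

A smaller condition is a stronger one. A sentence of the forcing language is represented by the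
set of the conditions that force it, and the connectives are the usual recursive clauses of the
forcing relation. -/

/-- Countable chain condition: every set of pairwise incompatible conditions is countable. -/
def IsCCC (P : Type u) [Preorder P] : Prop :=
  ∀ A : Set P, (∀ p ∈ A, ∀ q ∈ A, p ≠ q → ¬ ∃ r, r ≤ p ∧ r ≤ q) → A.Countable

/-- A nice name for a subset of the ground model set `A`: the pair `(a, s)` puts `a` into the
set that is named whenever `s` is in the generic filter. Every subset of `A` in a generic
extension has such a name. -/
abbrev NiceName (P : Type u) (A : Type v) : Type (max u v) := Set (A × P)

section ForcingLanguage

variable {P : Type u} [Preorder P]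

/-- `p ⊩ φ` for a sentence `φ` about the ground model, true or false there. -/
def fCheck (φ : Prop) : P → Prop := fun _ => φ

/-- `p ⊩ a ∈ X` for a nice name `X`: densely many `q` below `p` are below some `s` with
`(a, s) ∈ X`. -/
def fMem {A : Type v} (a : A) (X : NiceName P A) : P → Prop :=
  fun p => ∀ q ≤ p, ∃ r ≤ q, ∃ s, (a, s) ∈ X ∧ r ≤ s

/-- `p ⊩ ¬ φ`. -/
def fNot (φ : P → Prop) : P → Prop := fun p => ∀ q ≤ p, ¬ φ q

/-- `p ⊩ φ ∧ ψ`. -/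
def fAnd (φ ψ : P → Prop) : P → Prop := fun p => φ p ∧ ψ p

/-- `p ⊩ φ → ψ`. -/
def fImp (φ ψ : P → Prop) : P → Prop := fun p => ∀ q ≤ p, φ q → ψ q

/-- `p ⊩ ∀ i, φ i`. -/
def fAll {I : Type w} (φ : I → P → Prop) : P → Prop := fun p => ∀ i, φ i p

/-- `p ⊩ ∃ i, φ i`. -/
def fEx {I : Type w} (φ : I → P → Prop) : P → Prop := fun p => ∀ q ≤ p, ∃ r ≤ q, ∃ i, φ i r

/-- `p ⊩ "S is countable"`: it forces that there is a set `f` of pairs `(n, a)` which is a partial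
function of `n ∈ ω` and takes every element of `S` as a value. -/
def fCountable {A : Type v} (S : NiceName P A) : P → Prop :=
  fEx fun f : NiceName P (ℕ × A) =>
    fAnd
      (fAll fun n : ℕ => fAll fun a : A => fAll fun b : A =>
        fImp (fAnd (fMem (n, a) f) (fMem (n, b) f)) (fCheck (a = b)))
      (fAll fun a : A => fImp (fMem a S) (fEx fun n : ℕ => fMem (n, a) f))

/-- `p ⊩ "F is n-capturing"`. The relation of being captured at a level is absolute, and so are
the finite sequences of finite subsets of `ω₁`. -/
def fCapturing (τ : SchemeType) (F : Set (Finset OmegaOne.{u})) (n : ℕ) : P → Prop :=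
  fAll fun S : NiceName P FinOmegaOne.{u} =>
    fImp (fNot (fCountable S))
      (fAll fun k : ℕ => fEx fun l : ℕ => fEx fun D : Fin n → FinOmegaOne.{u} =>
        fAnd (fCheck (k ≤ l ∧ IsCapturedAt τ F (fun i => (D i : Finset OmegaOne.{u})) l))
          (fAll fun i : Fin n => fMem (D i) S))

end ForcingLanguage

/-- `P` `n`-preserves `F`: every condition of `P` forces that `F` is `n`-capturing. -/
def Preserves (P : Type u) [Preorder P] (τ : SchemeType) (F : Set (Finset OmegaOne.{u}))
    (n : ℕ) : Prop :=
  ∀ p : P, fCapturing τ F n p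

/-! ### Martin's numbers -/

/-- `D` is dense in `P`. -/
def IsDenseIn (P : Type u) [Preorder P] (D : Set P) : Prop := ∀ p, ∃ d ∈ D, d ≤ p

/-- Martin's number `𝔪(P)`: the least cardinal `κ` for which there is a family of `κ` dense sets
that are not all met by one filter; `⊤` if there is none. -/
def martinNumber (P : Type u) [Preorder P] : WithTop Cardinal.{u} :=
  sInf {c : WithTop Cardinal.{u} | ∃ 𝒟 : Set (Set P),
    c = ((#𝒟 : Cardinal.{u}) : WithTop Cardinal.{u}) ∧
    (∀ D ∈ 𝒟, IsDenseIn P D) ∧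
    ¬ ∃ G : Order.PFilter P, ∀ D ∈ 𝒟, ((G : Set P) ∩ D).Nonempty}

open Classical in
/-- The parametrized Martin's number `𝔪ⁿ_F`: `ω` if `F` is not `n`-capturing, and otherwise the
least Martin's number of a (non-empty) ccc forcing notion that `n`-preserves `F`. -/
def schemeMartinNumber (τ : SchemeType) (F : Set (Finset OmegaOne.{u})) (n : ℕ) :
    WithTop Cardinal.{u} :=
  if IsCapturing τ F n then
    sInf {c : WithTop Cardinal.{u} | ∃ (P : Type u) (_ : Preorder P),
      Nonempty P ∧ IsCCC P ∧ Preserves P τ F n ∧ c = martinNumber P}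
  else ((ℵ₀ : Cardinal.{u}) : WithTop Cardinal.{u})

/-! ### Trees -/

/-- A partial order is a tree if the set of predecessors of each element is well-ordered. -/
def IsTreeOrder (T : Type u) [PartialOrder T] : Prop :=
  ∀ t : T, IsWellOrder (Set.Iio t) (· < ·)

/-- The level `α` of a tree: the elements whose set of predecessors has order type `α`. -/
def treeLevel (T : Type u) [PartialOrder T] (hT : IsTreeOrder T) (α : Ordinal.{u}) : Set T :=
  {t | @Ordinal.type (Set.Iio t) (· < ·) (hT t) = α}

/-- The height of a tree: the least ordinal whose level is empty. -/
def treeHeight (T : Type u) [PartialOrder T] (hT : IsTreeOrder T) : Ordinal.{u} :=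
  sInf {α | treeLevel T hT α = ∅}

/-- An `ω₁`-tree: height `ω₁` and countable levels. -/
def IsOmegaOneTree (T : Type u) [PartialOrder T] : Prop :=
  ∃ hT : IsTreeOrder T, treeHeight T hT = ω_ 1 ∧ ∀ α, (treeLevel T hT α).Countable

/-- An Aronszajn tree: an `ω₁`-tree without uncountable chains. -/
def IsAronszajnTree (T : Type u) [PartialOrder T] : Prop :=
  IsOmegaOneTree T ∧ ∀ C : Set T, IsChain (· ≤ ·) C → C.Countable

/-- A Suslin tree: an `ω₁`-tree without uncountable chains and without uncountable antichains
(sets of pairwise incomparable elements). -/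
def IsSuslinTree (T : Type u) [PartialOrder T] : Prop :=
  IsOmegaOneTree T ∧ (∀ C : Set T, IsChain (· ≤ ·) C → C.Countable) ∧
    ∀ A : Set T, IsAntichain (· ≤ ·) A → A.Countable

/-- A tree is special if it is the union of countably many (pairwise disjoint) antichains. -/
def IsSpecialTree (T : Type u) [PartialOrder T] : Prop :=
  ∃ f : T → ℕ, ∀ n, IsAntichain (· ≤ ·) {t | f t = n}

end

noncomputable section

/-! ### Uncountable sets -/

/-! Call a poset good if every assignment of conditions to an uncountable family of finite sets has
captured pairs, at arbitrarily high levels, with compatible conditions (`CapturesCompatible`). A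
good poset is ccc and preserves 2-capturing, so 𝔪_F > ω₁ yields filters meeting any ℵ₁ of its dense
sets.

The specializing poset of an ω₁-tree T is good once captured pairs can be found whose attached
tuples of nodes are coordinatewise incomparable (`CapturesIncomparable`); then T is special.

Let T be a Suslin tree, pruned so that all cones are uncountable. If T as a forcing is good, a
filter gives an uncountable chain, a contradiction. Otherwise some assignment E ↦ p(E) sends all
captured pairs of high level to incomparable nodes. Its values are dense above some node t, even
after deleting countably many E. Given tuples above t, choose such p(E) below their coordinates and
capture all the sets E, together with the prescribed finite sets, at one level
(`IsCapturing.exists_forall`). The tuples are then coordinatewise incomparable, so the cone of t is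
special, which is impossible for a Suslin tree.

Without Suslin trees, every uncountable subset of an Aronszajn tree has an uncountable antichain.
Passing to antichains in all coordinates before capturing gives `CapturesIncomparable`, and the tree
is special. -/

theorem exists_uncountable_fiber {ι : Type v} {γ : Type w} [Countable γ] {X : Set ι}
    (hX : ¬ X.Countable) (f : ι → γ) : ∃ c, ¬ {i ∈ X | f i = c}.Countable := by
  by_contra! h
  refine hX ((Set.countable_iUnion h).mono fun i hi => ?_)
  exact Set.mem_iUnion.2 ⟨f i, hi, rfl⟩

/-- Keep one index per value: if there were only countably many values, the countable fibers would
cover `X` countably. -/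
theorem exists_uncountable_injOn {ι : Type v} {γ : Type w} {X : Set ι}
    (hX : ¬ X.Countable) (f : ι → γ) (hf : ∀ c, {i ∈ X | f i = c}.Countable) :
    ∃ Y ⊆ X, ¬ Y.Countable ∧ Set.InjOn f Y := by
  obtain ⟨Y, hYX, hY⟩ := (Set.surjOn_image f X).exists_bijOn_subset
  refine ⟨Y, hYX, fun hc => hX ?_, hY.injOn⟩
  have him : (f '' X).Countable := hY.image_eq ▸ hc.image f
  refine (him.biUnion fun c _ => hf c).mono fun i hi => ?_
  exact Set.mem_biUnion (Set.mem_image_of_mem f hi) ⟨hi, rfl⟩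

/-- Finitely many properties that can be achieved on uncountable subsets and are inherited by
subsets can be achieved simultaneously. -/
theorem exists_uncountable_subset_forall {ι : Type v} {κ : Type w} [Finite κ]
    (Q : κ → Set ι → Prop) (mono : ∀ c X Y, Y ⊆ X → Q c X → Q c Y)
    (step : ∀ c X, ¬ X.Countable → ∃ Y ⊆ X, ¬ Y.Countable ∧ Q c Y)
    {X : Set ι} (hX : ¬ X.Countable) : ∃ Y ⊆ X, ¬ Y.Countable ∧ ∀ c, Q c Y := by
  classical
  have := Fintype.ofFinite κ
  suffices h : ∀ s : Finset κ, ∃ Y ⊆ X, ¬ Y.Countable ∧ ∀ c ∈ s, Q c Y by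
    simpa using h Finset.univ
  intro s
  induction s using Finset.induction_on with
  | empty => exact ⟨X, subset_rfl, hX, by simp⟩
  | insert c s _ ih =>
    obtain ⟨Y, hYX, hY, hQ⟩ := ih
    obtain ⟨Z, hZY, hZ, hc⟩ := step c Y hY
    refine ⟨Z, hZY.trans hYX, hZ, fun d hd => ?_⟩
    rcases Finset.mem_insert.1 hd with rfl | hd
    exacts [hc, mono d Y Z hZY (hQ d hd)]

theorem not_countable_diff {ι : Type v} {X Y : Set ι} (hX : ¬ X.Countable)
    (hY : (X \ Y).Countable) : ¬ {i ∈ X | i ∈ Y}.Countable := fun h =>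
  hX ((hY.union h).mono fun i hi => by
    by_cases hiY : i ∈ Y
    exacts [Or.inr ⟨hi, hiY⟩, Or.inl ⟨hi, hiY⟩])

/-! ### Recursion along the first uncountable ordinal -/

theorem countable_iff_card_lt_omega_one {o : Ordinal.{u}} : o < ω_ 1 ↔ o.card ≤ ℵ₀ := by
  rw [← Cardinal.ord_aleph, Cardinal.lt_ord, Cardinal.lt_aleph_one_iff]

/-- The ordinal below `ω₁` that corresponds to an element of `OmegaOne`. -/
def OmegaOne.toOrdinal (a : OmegaOne.{u}) : Ordinal.{u} :=
  Ordinal.typein (α := OmegaOne.{u}) (· < ·) a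

theorem OmegaOne.toOrdinal_lt (a : OmegaOne.{u}) : a.toOrdinal < ω_ 1 := by
  have := Ordinal.typein_lt_type (α := OmegaOne.{u}) (· < ·) a
  rwa [Ordinal.type_toType] at this

theorem OmegaOne.toOrdinal_injective : Function.Injective OmegaOne.toOrdinal.{u} :=
  Ordinal.typein_injective (α := OmegaOne.{u}) (· < ·)

theorem OmegaOne.exists_toOrdinal {o : Ordinal.{u}} (ho : o < ω_ 1) :
    ∃ a : OmegaOne.{u}, a.toOrdinal = o :=
  Ordinal.typein_surj (α := OmegaOne.{u}) (· < ·) (by rwa [Ordinal.type_toType])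

theorem OmegaOne.countable_Iio (a : OmegaOne.{u}) : (Set.Iio a).Countable := by
  have h := countable_iff_card_lt_omega_one.1 a.toOrdinal_lt
  rw [OmegaOne.toOrdinal, ← Ordinal.type_subrel, Ordinal.card_type] at h
  exact Cardinal.le_aleph0_iff_set_countable.1 h

theorem OmegaOne.mk_eq : #OmegaOne.{u} = ℵ_ 1 := by
  simp [OmegaOne]

theorem OmegaOne.not_countable_univ : ¬ (Set.univ : Set OmegaOne.{u}).Countable := by
  rw [← Cardinal.le_aleph0_iff_set_countable, Cardinal.mk_univ, OmegaOne.mk_eq, not_le]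
  exact Cardinal.aleph0_lt_aleph_one

/-- A choice along `ω₁` that is injective in each of countably many coordinates. -/
theorem OmegaOne.exists_choice {Z : Type v} {κ : Type w} {ι : Type*} (f : κ → Z → ι)
    (G : OmegaOne.{u} → Set Z)
    (h : ∀ a, ∀ C : κ → Set ι, (∀ c, (C c).Countable) → ∃ z ∈ G a, ∀ c, f c z ∉ C c) :
    ∃ z : OmegaOne.{u} → Z, (∀ a, z a ∈ G a) ∧ ∀ c, Function.Injective fun a => f c (z a) := by
  have h' : ∀ (a : OmegaOne.{u}) (y : ∀ b, b < a → Z),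
      ∃ z ∈ G a, ∀ c, ∀ b (hb : b < a), f c z ≠ f c (y b hb) := by
    intro a y
    have : Countable (Set.Iio a) := (OmegaOne.countable_Iio a).to_subtype
    obtain ⟨z, hz, hC⟩ := h a (fun c => Set.range fun b : Set.Iio a => f c (y b b.2))
      fun c => Set.countable_range _
    exact ⟨z, hz, fun c b hb he => hC c ⟨⟨b, hb⟩, he.symm⟩⟩
  choose H hG hne using h'
  let z : OmegaOne.{u} → Z := (wellFounded_lt (α := OmegaOne.{u})).fix H
  have hz : ∀ a, z a = H a fun b _ => z b := fun a => WellFounded.fix_eq _ _ _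
  have hlt : ∀ c a b, b < a → f c (z a) ≠ f c (z b) := by
    intro c a b hb
    rw [hz a]
    exact hne a _ c b hb
  refine ⟨z, fun a => hz a ▸ hG a _, fun c a b hab => ?_⟩
  rcases lt_trichotomy a b with hl | rfl | hl
  exacts [absurd hab.symm (hlt c b a hl), rfl, absurd hab (hlt c a b hl)]

/-! ### Captured pairs -/

theorem orderEmbOfFin_mem_iff_lt_card {A R : Finset OmegaOne.{u}} {m : ℕ} (hA : A.card = m)
    (hRA : R ⊆ A) (hlt : FinsetLT R (A \ R)) (b : Fin m) :
    A.orderEmbOfFin hA b ∈ R ↔ (b : ℕ) < R.card := by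
  classical
  constructor
  · intro hb
    have hsub : (Finset.Iic b).image (A.orderEmbOfFin hA) ⊆ R := by
      intro x hx
      obtain ⟨c, hc, rfl⟩ := Finset.mem_image.1 hx
      by_contra hcR
      have h1 := hlt _ hb _ (Finset.mem_sdiff.2 ⟨A.orderEmbOfFin_mem hA c, hcR⟩)
      exact absurd ((A.orderEmbOfFin hA).lt_iff_lt.1 h1) (not_lt.2 (Finset.mem_Iic.1 hc))
    have h := Finset.card_le_card hsub
    rw [Finset.card_image_of_injective _ (A.orderEmbOfFin hA).injective, Fin.card_Iic] at h
    omega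
  · intro hb
    by_contra hbR
    have hsub : R ⊆ (Finset.Iio b).image (A.orderEmbOfFin hA) := by
      intro x hx
      have hxA : x ∈ Set.range (A.orderEmbOfFin hA) := by
        rw [Finset.range_orderEmbOfFin]; exact hRA hx
      obtain ⟨c, rfl⟩ := hxA
      have h1 := hlt _ hx _ (Finset.mem_sdiff.2 ⟨A.orderEmbOfFin_mem hA b, hbR⟩)
      exact Finset.mem_image_of_mem _ (Finset.mem_Iio.2 ((A.orderEmbOfFin hA).lt_iff_lt.1 h1))
    have h := Finset.card_le_card hsub
    rw [Finset.card_image_of_injective _ (A.orderEmbOfFin hA).injective, Fin.card_Iio] at h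
    omega

/-- The elements of a captured pair at a fixed set of positions form a captured pair, unless they
are all in the root. -/
theorem IsCapturedAt.restrict {τ : SchemeType} {F : Set (Finset OmegaOne.{u})}
    {C A : Fin 2 → Finset OmegaOne.{u}} {l : ℕ} (hC : IsCapturedAt τ F C l)
    (hA : Function.Injective A) (hAC : ∀ i, A i ⊆ C i) (I : ℕ → Prop)
    (hI : ∀ i m (hm : (C i).card = m) (a : Fin m), (C i).orderEmbOfFin hm a ∈ A i ↔ I a) :
    IsCapturedAt τ F A l := by
  classical
  obtain ⟨-, m, hm, R, -, hinter, hroot, htail, hXi, hcap⟩ := hC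
  have hRC : ∀ i, R ⊆ C i := by
    intro i
    have : ∃ j, i ≠ j := exists_ne i |>.imp fun _ h => h.symm
    obtain ⟨j, hj⟩ := this
    rw [← hinter i j hj]
    exact Finset.inter_subset_left
  have hpos := fun i a => orderEmbOfFin_mem_iff_lt_card (hm i) (hRC i) (hroot i) a
  -- The root is an initial segment of both sets, so a root element has the same position in each.
  have heqR : ∀ i j a, (C i).orderEmbOfFin (hm i) a ∈ R →
      (C i).orderEmbOfFin (hm i) a = (C j).orderEmbOfFin (hm j) a := by
    intro i j a ha
    have hcard : R.card ≤ m := (Finset.card_le_card (hRC i)).trans_eq (hm i)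
    have hR : ∀ i, (fun b : Fin R.card => (C i).orderEmbOfFin (hm i) (Fin.castLE hcard b)) =
        R.orderEmbOfFin rfl := fun i =>
      Finset.orderEmbOfFin_unique rfl (fun b => (hpos i _).2 b.2) fun b c hbc =>
        ((C i).orderEmbOfFin (hm i)).strictMono (by simpa using hbc)
    exact congrFun ((hR i).trans (hR j).symm) ⟨a, (hpos i a).1 ha⟩
  let J : Finset (Fin m) := Finset.univ.filter fun a => I a
  have hJ : ∀ a, a ∈ J ↔ I a := by simp [J]
  have himg : ∀ i, A i = J.image ((C i).orderEmbOfFin (hm i)) := by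
    intro i
    ext x
    constructor
    · intro hx
      have hxC : x ∈ Set.range ((C i).orderEmbOfFin (hm i)) := by
        rw [Finset.range_orderEmbOfFin]; exact hAC i hx
      obtain ⟨a, rfl⟩ := hxC
      exact Finset.mem_image_of_mem _ ((hJ a).2 ((hI i m (hm i) a).1 hx))
    · intro hx
      obtain ⟨a, ha, rfl⟩ := Finset.mem_image.1 hx
      exact (hI i m (hm i) a).2 ((hJ a).1 ha)
  have hAcard : ∀ i, (A i).card = J.card := fun i => by
    rw [himg i, Finset.card_image_of_injective _ ((C i).orderEmbOfFin (hm i)).injective]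
  have hemb : ∀ i b, (A i).orderEmbOfFin (hAcard i) b =
      (C i).orderEmbOfFin (hm i) (J.orderEmbOfFin rfl b) := by
    intro i b
    have := Finset.orderEmbOfFin_unique (hAcard i)
      (f := fun b => (C i).orderEmbOfFin (hm i) (J.orderEmbOfFin rfl b))
      (fun b => (hI i m (hm i) _).2 ((hJ _).1 (J.orderEmbOfFin_mem rfl b)))
      (fun b c hbc => by simpa using hbc)
    exact (congrFun this b).symm
  have hmemR : ∀ i x, x ∈ A i → (x ∈ A 0 ∩ A 1 ↔ x ∈ R) := by
    intro i x hx
    constructor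
    · intro h
      rw [← hinter 0 1 (by decide)]
      exact Finset.inter_subset_inter (hAC 0) (hAC 1) h
    · intro h
      rw [himg i] at hx
      obtain ⟨a, ha, rfl⟩ := Finset.mem_image.1 hx
      have hall : ∀ j, (C i).orderEmbOfFin (hm i) a ∈ A j := fun j => by
        rw [heqR i j a h]
        exact (hI j m (hm j) a).2 ((hJ a).1 ha)
      exact Finset.mem_inter.2 ⟨hall 0, hall 1⟩
  have hsub : ∀ i, A 0 ∩ A 1 ⊆ A i := by
    intro i
    fin_cases i
    exacts [Finset.inter_subset_left, Finset.inter_subset_right]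
  have hsdiff : ∀ i, A i \ (A 0 ∩ A 1) ⊆ C i \ R := fun i x hx => by
    rw [Finset.mem_sdiff] at hx ⊢
    exact ⟨hAC i hx.1, fun h => hx.2 ((hmemR i x hx.1).2 h)⟩
  have hroot' : ∀ i, FinsetLT (A 0 ∩ A 1) (A i \ (A 0 ∩ A 1)) := fun i x hx y hy =>
    hroot i x ((hmemR i x (hsub i hx)).1 hx) y (hsdiff i hy)
  have hrank : ∀ b : Fin J.card,
      ((b : ℕ) < (A 0 ∩ A 1).card ↔ (J.orderEmbOfFin rfl b : ℕ) < R.card) := by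
    intro b
    rw [← orderEmbOfFin_mem_iff_lt_card (hAcard 0) (hsub 0) (hroot' 0),
      hmemR 0 _ ((A 0).orderEmbOfFin_mem _ b), hemb, hpos]
  refine ⟨hA, J.card, hAcard, A 0 ∩ A 1, ?_, ?_, hroot', ?_, ?_, ?_⟩
  -- Size zero would make both sets empty, against injectivity of `A`.
  · by_contra h
    have h0 : ∀ i, A i = ∅ := fun i => Finset.card_eq_zero.1 (by rw [hAcard i]; omega)
    exact absurd (hA ((h0 0).trans (h0 1).symm)) (by decide)
  · intro i j hij
    fin_cases i <;> fin_cases j <;> first | exact absurd rfl hij | rfl | exact Finset.inter_comm _ _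
  · intro i j hij
    refine (htail i j hij).imp ?_ ?_ <;>
    exact fun h x hx y hy => h x (hsdiff _ hx) y (hsdiff _ hy)
  · intro i b
    rw [hemb, hXi]
    simp only [hrank]
  · intro i j b hij hb
    rw [hemb, hemb]
    exact hcap i j _ hij (not_lt.1 fun h => not_lt.2 hb ((hrank b).2 h))

/-- Joint capturing: if `F` is `2`-capturing, then there are two indices for which finitely many
families of finite sets are captured at the same level. -/
theorem IsCapturing.exists_forall {τ : SchemeType} {F : Set (Finset OmegaOne.{u})}
    (hF : IsCapturing τ F 2) {ι : Type v} {κ : Type w} [Finite κ] [Nonempty κ]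
    {X : Set ι} (hX : ¬ X.Countable) (A : κ → ι → FinOmegaOne.{u})
    (hA : ∀ c, Set.InjOn (A c) X) (k : ℕ) :
    ∃ l, k ≤ l ∧ ∃ i : Fin 2 → ι, (∀ e, i e ∈ X) ∧
      ∀ c, IsCapturedAt τ F (fun e => (A c (i e) : Finset OmegaOne.{u})) l := by
  classical
  have := Fintype.ofFinite κ
  -- Capture the union of all families once, then restrict to each family. A fiber of `C` is finite,
  -- because it injects into the subsets of one finite set.
  let C : ι → Finset OmegaOne.{u} := fun i => Finset.univ.biUnion fun c => (A c i).1
  have hAC : ∀ c i, (A c i).1 ⊆ C i := fun c i =>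
    Finset.subset_biUnion_of_mem (fun c => (A c i).1) (Finset.mem_univ c)
  have hCne : ∀ i, (C i).Nonempty := fun i =>
    (A (Classical.arbitrary κ) i).2.mono (hAC _ i)
  obtain ⟨Y, hYX, hY, hCY⟩ := exists_uncountable_injOn hX C (fun D => by
    refine Set.Finite.countable (Set.Finite.of_finite_image (f := fun i =>
      (A (Classical.arbitrary κ) i).1) ?_ ?_)
    · refine D.powerset.finite_toSet.subset ?_
      rintro _ ⟨i, ⟨-, rfl⟩, rfl⟩
      exact Finset.mem_coe.2 (Finset.mem_powerset.2 (hAC _ i))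
    · intro i hi j hj hij
      exact hA _ hi.1 hj.1 (Subtype.ext hij))
  let pos : Finset OmegaOne.{u} → OmegaOne.{u} → ℕ := fun D x => (D.filter (· < x)).card
  have hpos : ∀ (D : Finset OmegaOne.{u}) m (hm : D.card = m) (a : Fin m),
      pos D (D.orderEmbOfFin hm a) = a := by
    intro D m hm a
    have : D.filter (· < D.orderEmbOfFin hm a) = (Finset.Iio a).image (D.orderEmbOfFin hm) := by
      ext x
      simp only [Finset.mem_filter, Finset.mem_image, Finset.mem_Iio]
      constructor
      · rintro ⟨hx, hlt⟩
        have hxr : x ∈ Set.range (D.orderEmbOfFin hm) := by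
          rw [Finset.range_orderEmbOfFin]; exact hx
        obtain ⟨b, rfl⟩ := hxr
        exact ⟨b, (D.orderEmbOfFin hm).lt_iff_lt.1 hlt, rfl⟩
      · rintro ⟨b, hb, rfl⟩
        exact ⟨D.orderEmbOfFin_mem hm b, (D.orderEmbOfFin hm).lt_iff_lt.2 hb⟩
    simp only [pos, this]
    rw [Finset.card_image_of_injective _ (D.orderEmbOfFin hm).injective, Fin.card_Iio]
  -- There are only countably many patterns of positions of the sets `A c i` inside `C i`. Fixing
  -- the pattern is what allows `IsCapturedAt.restrict` to be applied.
  obtain ⟨I, hI⟩ := exists_uncountable_fiber hY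
    (fun i => fun c : κ => (A c i).1.image (pos (C i)))
  set Z := {i ∈ Y | (fun c : κ => (A c i).1.image (pos (C i))) = I}
  have hZY : Z ⊆ Y := fun i hi => hi.1
  have hmem : ∀ i ∈ Z, ∀ c m (hm : (C i).card = m) (a : Fin m),
      (C i).orderEmbOfFin hm a ∈ (A c i).1 ↔ (a : ℕ) ∈ I c := by
    intro i hi c m hm a
    rw [← congrFun hi.2 c]
    constructor
    · intro h
      exact Finset.mem_image.2 ⟨_, h, hpos _ m hm a⟩
    · intro h
      obtain ⟨x, hx, hxa⟩ := Finset.mem_image.1 h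
      have hxr : x ∈ Set.range ((C i).orderEmbOfFin hm) := by
        rw [Finset.range_orderEmbOfFin]; exact hAC c i hx
      obtain ⟨b, rfl⟩ := hxr
      rw [hpos] at hxa
      rwa [← Fin.ext hxa]
  obtain ⟨l, hl, D, hD, hDZ⟩ := hF ((fun i => (⟨C i, hCne i⟩ : FinOmegaOne.{u})) '' Z)
    (fun h => hI (Set.countable_of_injective_of_countable_image (fun i hi j hj hij =>
      hCY (hZY hi) (hZY hj) (congrArg Subtype.val hij)) h)) k
  choose i hi hiD using hDZ
  have hDC : (fun e => (D e : Finset OmegaOne.{u})) = fun e => C (i e) := by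
    funext e
    rw [← hiD e]
  rw [hDC] at hD
  refine ⟨l, hl, i, fun e => hYX (hZY (hi e)), fun c => hD.restrict ?_ (fun e => hAC c _)
    (fun n => n ∈ I c) fun e m hm a => hmem _ (hi e) c m hm a⟩
  intro e e' he
  exact hD.1 (congrArg C (hA c (hYX (hZY (hi e))) (hYX (hZY (hi e'))) (Subtype.ext he)))

/-! ### Preservation of `2`-capturing -/

/-- Every assignment of conditions to an uncountable family of finite sets has captured pairs at
arbitrarily high levels whose conditions are compatible. -/
def CapturesCompatible (P : Type u) [Preorder P] (τ : SchemeType)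
    (F : Set (Finset OmegaOne.{u})) : Prop :=
  ∀ X : Set FinOmegaOne.{u}, ¬ X.Countable → ∀ (p : FinOmegaOne.{u} → P) (k : ℕ),
    ∃ l, k ≤ l ∧ ∃ D : Fin 2 → FinOmegaOne.{u},
      IsCapturedAt τ F (fun i => (D i : Finset OmegaOne.{u})) l ∧ (∀ i, D i ∈ X) ∧
      ∃ r, ∀ i, r ≤ p (D i)

theorem exists_injective_omegaOne_of_not_countable {P : Type u} {A : Set P}
    (hA : ¬ A.Countable) : ∃ f : OmegaOne.{u} → P, Function.Injective f ∧ ∀ a, f a ∈ A := by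
  obtain ⟨z, hz, hinj⟩ := OmegaOne.exists_choice (Z := P) (κ := Unit) (fun _ x => x)
    (fun _ => A) fun _ C hC => by
      by_contra! h
      exact hA ((hC ()).mono fun x hx => (h x hx).elim fun _ => id)
  exact ⟨z, hinj (), hz⟩

section

variable {P : Type u} [Preorder P] {τ : SchemeType} {F : Set (Finset OmegaOne.{u})}

/-- An uncountable antichain could be indexed by singletons of ω₁. A captured pair of singletons
would then give two distinct compatible members. -/
theorem CapturesCompatible.isCCC (h : CapturesCompatible P τ F) : IsCCC P := by
  intro A hA
  by_contra hc
  obtain ⟨f, hf, hfA⟩ := exists_injective_omegaOne_of_not_countable hc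
  have hs : Function.Injective fun a : OmegaOne.{u} =>
      (⟨{a}, Finset.singleton_nonempty a⟩ : FinOmegaOne.{u}) := fun a b hab =>
    Finset.singleton_injective (congrArg Subtype.val hab)
  obtain ⟨l, -, D, hD, hDX, r, hr⟩ := h (Set.range fun a : OmegaOne.{u} =>
      (⟨{a}, Finset.singleton_nonempty a⟩ : FinOmegaOne.{u}))
    (fun hcount => OmegaOne.not_countable_univ
      (Set.countable_of_injective_of_countable_image hs.injOn (by rwa [Set.image_univ])))
    (fun E => f (E.1.min' E.2)) 0
  choose a ha using hDX
  have hmin : ∀ i, (D i).1.min' (D i).2 = a i := fun i => by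
    simp only [← ha i, Finset.min'_singleton]
  have hne : f (a 0) ≠ f (a 1) := fun he => by
    have h01 : D 0 = D 1 := by rw [← ha 0, ← ha 1, hf he]
    exact absurd (hD.1 (congrArg Subtype.val h01)) (by decide)
  refine hA _ (hfA _) _ (hfA _) hne ⟨r, ?_, ?_⟩
  · simpa only [hmin] using hr 0
  · simpa only [hmin] using hr 1

theorem fMem_mono {A : Type v} {a : A} {X : NiceName P A} {p q : P} (hqp : q ≤ p)
    (hp : fMem a X p) : fMem a X q := fun r hr => hp r (hr.trans hqp)

/-- If only countably many elements can be forced into a set below a condition, then the condition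
forces that the set is countable. -/
theorem fCountable_of_countable {A : Type v} {S : NiceName P A} {p : P}
    (h : {a | ∃ q ≤ p, fMem a S q}.Countable) : fCountable S p := by
  obtain ⟨g, hg⟩ := Set.countable_iff_exists_injOn.1 h
  -- A name for the ground-model enumeration given by `g`: every condition puts every pair of it in.
  let f : NiceName P (ℕ × A) :=
    {z | z.1.2 ∈ {a | ∃ q ≤ p, fMem a S q} ∧ g z.1.2 = z.1.1}
  have hf : ∀ n a (q : P), fMem (n, a) f q ↔ (∃ q ≤ p, fMem a S q) ∧ g a = n := by
    intro n a q
    constructor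
    · intro hq
      obtain ⟨r, -, s, hs, -⟩ := hq q le_rfl
      exact hs
    · exact fun ha r _ => ⟨r, le_rfl, r, ha, le_rfl⟩
  refine fun q hq => ⟨q, le_rfl, f, fun n a b r _ hr => ?_, fun a r hr ha t ht => ?_⟩
  · obtain ⟨ha, hna⟩ := (hf n a r).1 hr.1
    obtain ⟨hb, hnb⟩ := (hf n b r).1 hr.2
    exact hg ha hb (hna.trans hnb.symm)
  · exact ⟨t, le_rfl, g a, (hf _ _ _).2 ⟨⟨r, hr.trans hq, ha⟩, rfl⟩⟩

/-- Below a condition forcing a name to be uncountable, uncountably many sets can each be forced in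
by some condition. A common extension of the conditions of a captured pair forces both of its sets
in. -/
theorem CapturesCompatible.preserves (h : CapturesCompatible P τ F) : Preserves P τ F 2 := by
  intro p S q _ hS k q' hq'
  have hX : ¬ {D : FinOmegaOne.{u} | ∃ r ≤ q', fMem D S r}.Countable := fun hc =>
    hS q' hq' (fCountable_of_countable hc)
  have hr : ∀ D : FinOmegaOne.{u}, ∃ r ≤ q', (∃ r ≤ q', fMem D S r) → fMem D S r := by
    intro D
    by_cases hD : ∃ r ≤ q', fMem D S r
    · obtain ⟨r, hr, hrD⟩ := hD
      exact ⟨r, hr, fun _ => hrD⟩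
    · exact ⟨q', le_rfl, fun hD' => absurd hD' hD⟩
  choose r hrq hrS using hr
  obtain ⟨l, hl, D, hD, hDX, t, ht⟩ := h _ hX r k
  refine ⟨t, (ht 0).trans (hrq _), l, fun t' ht' => ⟨t', le_rfl, D, ⟨hl, hD⟩, fun i => ?_⟩⟩
  exact fMem_mono (ht'.trans (ht i)) (hrS _ (hDX i))

/-- If `𝔪_F > ω₁`, then `ℵ₁` many dense subsets of a poset as above are met by a filter. -/
theorem CapturesCompatible.exists_filter [Nonempty P] (h : CapturesCompatible P τ F)
    (hcap : IsCapturing τ F 2)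
    (hm : ((ℵ_ 1 : Cardinal.{u}) : WithTop Cardinal.{u}) < schemeMartinNumber τ F 2)
    {ι : Type u} (hι : #ι ≤ ℵ_ 1) (D : ι → Set P) (hD : ∀ i, IsDenseIn P (D i)) :
    ∃ G : Order.PFilter P, ∀ i, ((G : Set P) ∩ D i).Nonempty := by
  by_contra hG
  have h1 : schemeMartinNumber τ F 2 ≤ martinNumber P := by
    rw [schemeMartinNumber, if_pos hcap]
    exact csInf_le' ⟨P, _, inferInstance, h.isCCC, h.preserves, rfl⟩
  have h2 : martinNumber P ≤ ((#(Set.range D) : Cardinal.{u}) : WithTop Cardinal.{u}) := by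
    refine csInf_le' ⟨Set.range D, rfl, ?_, ?_⟩
    · rintro _ ⟨i, rfl⟩
      exact hD i
    · rintro ⟨G, hGD⟩
      exact hG ⟨G, fun i => hGD _ ⟨i, rfl⟩⟩
  have h3 : ((#(Set.range D) : Cardinal.{u}) : WithTop Cardinal.{u}) ≤ (ℵ_ 1 : Cardinal.{u}) :=
    WithTop.coe_le_coe.2 (Cardinal.mk_range_le.trans hι)
  exact absurd hm (not_lt.2 (h1.trans (h2.trans h3)))

end

/-! ### Trees -/

/-- Two elements of a tree are incomparable. -/
def TreeIncomp {T : Type u} [PartialOrder T] (s t : T) : Prop := ¬ s ≤ t ∧ ¬ t ≤ s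

namespace IsTreeOrder

variable {T : Type u} [PartialOrder T]

theorem le_or_le (hT : IsTreeOrder T) {s t u : T} (hs : s ≤ u) (ht : t ≤ u) : s ≤ t ∨ t ≤ s := by
  rcases hs.eq_or_lt with rfl | hs
  · exact Or.inr ht
  rcases ht.eq_or_lt with rfl | ht
  · exact Or.inl hs.le
  have := hT u
  by_contra! h
  have := this.trichotomous ⟨s, hs⟩ ⟨t, ht⟩ (fun hlt => h.1 (le_of_lt hlt))
    (fun hlt => h.2 (le_of_lt hlt))
  exact h.1 (congrArg Subtype.val this).le

/-- If the upper nodes were comparable, the lower ones would have a common upper bound, below which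
a tree is linear. -/
theorem incomp_mono (hT : IsTreeOrder T) {s s' t t' : T} (h : TreeIncomp s t)
    (hs : s ≤ s') (ht : t ≤ t') :
    TreeIncomp s' t' := by
  constructor
  · intro hle
    exact (hT.le_or_le (hs.trans hle) ht).elim h.1 h.2
  · intro hle
    exact (hT.le_or_le hs (ht.trans hle)).elim h.1 h.2

theorem subtype (hT : IsTreeOrder T) (Y : T → Prop) : IsTreeOrder {t // Y t} := by
  intro t
  have := hT t.1
  let f : (fun a b : Set.Iio t => a < b) ↪r (fun a b : Set.Iio t.1 => a < b) :=
    ⟨⟨fun a => ⟨a.1.1, a.2⟩, fun a b hab => Subtype.ext (Subtype.ext (congrArg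
      (fun x : Set.Iio t.1 => x.1) hab))⟩, Iff.rfl⟩
  exact f.isWellOrder

/-- The height of an element of a tree. -/
def height (hT : IsTreeOrder T) (t : T) : Ordinal.{u} := @Ordinal.type (Set.Iio t) (· < ·) (hT t)

theorem height_eq_typein (hT : IsTreeOrder T) {s t : T} (h : s < t) :
    hT.height s = @Ordinal.typein (Set.Iio t) (· < ·) (hT t) ⟨s, h⟩ := by
  have := hT t
  have := hT s
  rw [← Ordinal.type_subrel]
  refine RelIso.ordinalType_congr ⟨⟨fun x => ⟨⟨x.1, lt_trans x.2 h⟩, x.2⟩, fun x => ⟨x.1.1, x.2⟩,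
    fun _ => rfl, fun _ => rfl⟩, Iff.rfl⟩

theorem height_lt (hT : IsTreeOrder T) {s t : T} (h : s < t) : hT.height s < hT.height t := by
  rw [hT.height_eq_typein h]
  have := hT t
  exact Ordinal.typein_lt_type _ _

theorem exists_height_eq (hT : IsTreeOrder T) {t : T} {o : Ordinal.{u}} (h : o ≤ hT.height t) :
    ∃ s ≤ t, hT.height s = o := by
  rcases h.eq_or_lt with rfl | h
  · exact ⟨t, le_rfl, rfl⟩
  have := hT t
  obtain ⟨s, hs⟩ := Ordinal.typein_surj (α := Set.Iio t) (· < ·) h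
  exact ⟨s, le_of_lt s.2, (hT.height_eq_typein s.2).trans hs⟩

theorem incomp_of_height_eq (hT : IsTreeOrder T) {s t : T} (h : hT.height s = hT.height t)
    (hne : s ≠ t) :
    TreeIncomp s t :=
  ⟨fun hle => (hT.height_lt (lt_of_le_of_ne hle hne)).ne h,
    fun hle => (hT.height_lt (lt_of_le_of_ne hle hne.symm)).ne' h⟩

end IsTreeOrder

section

variable {T : Type u} [PartialOrder T]

/-- In an `ω₁`-tree all elements have countable height and all initial parts are countable. -/
theorem IsOmegaOneTree.exists_height (h : IsOmegaOneTree T) :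
    ∃ hT : IsTreeOrder T, (∀ t, hT.height t < ω_ 1) ∧
      (∀ o, {t | hT.height t = o}.Countable) ∧
      (∀ o < ω_ 1, {t | hT.height t < o}.Countable) ∧ ∀ o < ω_ 1, ∃ t, hT.height t = o := by
  obtain ⟨hT, hht, hlev⟩ := h
  have hne : {o | treeLevel T hT o = ∅}.Nonempty := by
    by_contra hemp
    rw [Set.not_nonempty_iff_eq_empty] at hemp
    rw [treeHeight, hemp, Ordinal.sInf_empty] at hht
    exact absurd hht.symm (Ordinal.omega_pos 1).ne'
  have hempty : treeLevel T hT (ω_ 1) = ∅ := by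
    have := csInf_mem hne
    rwa [← treeHeight, hht] at this
  refine ⟨hT, fun t => ?_, hlev, fun o ho => ?_, fun o ho => ?_⟩
  · by_contra! hle
    obtain ⟨s, -, hs⟩ := hT.exists_height_eq hle
    exact (Set.eq_empty_iff_forall_notMem.1 hempty) s hs
  · obtain ⟨a, rfl⟩ := OmegaOne.exists_toOrdinal ho
    refine ((OmegaOne.countable_Iio a).biUnion fun b _ => hlev b.toOrdinal).mono fun t ht => ?_
    have ht' : hT.height t < a.toOrdinal := ht
    obtain ⟨b, hb⟩ := OmegaOne.exists_toOrdinal (ht'.trans a.toOrdinal_lt)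
    refine Set.mem_biUnion (x := b) ?_ hb.symm
    rw [← hb] at ht'
    exact (Ordinal.typein_lt_typein (α := OmegaOne.{u}) (· < ·)).1 ht'
  · by_contra! hno
    have hmem : o ∈ {o | treeLevel T hT o = ∅} := Set.eq_empty_iff_forall_notMem.2 hno
    have : treeHeight T hT ≤ o := csInf_le' hmem
    rw [hht] at this
    exact absurd ho (not_lt.2 this)

theorem IsOmegaOneTree.not_countable (h : IsOmegaOneTree T) :
    ¬ (Set.univ : Set T).Countable := by
  obtain ⟨hT, -, -, -, hex⟩ := h.exists_height
  choose t ht using fun a : OmegaOne.{u} => hex _ a.toOrdinal_lt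
  intro hc
  refine OmegaOne.not_countable_univ (Set.countable_of_injective_of_countable_image
    (f := t) (fun a _ b _ hab => OmegaOne.toOrdinal_injective ?_)
    (hc.mono (Set.subset_univ _)))
  rw [← ht a, ← ht b, hab]

/-- Bounds the number of dense sets needed for specializing, one for each node. -/
theorem IsOmegaOneTree.mk_le (h : IsOmegaOneTree T) : #T ≤ ℵ_ 1 := by
  obtain ⟨hT, hlt, hlev, -, -⟩ := h.exists_height
  choose a ha using fun t => OmegaOne.exists_toOrdinal (hlt t)
  have : (⋃ b : OmegaOne.{u}, {t | hT.height t = b.toOrdinal}) = Set.univ :=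
    Set.eq_univ_of_forall fun t => Set.mem_iUnion.2 ⟨a t, (ha t).symm⟩
  rw [← Cardinal.mk_univ, ← this]
  refine (Cardinal.mk_iUnion_le _).trans ?_
  rw [OmegaOne.mk_eq]
  refine (mul_le_mul_right (ciSup_le' fun b : OmegaOne.{u} =>
    Cardinal.le_aleph0_iff_set_countable.2 (hlev b.toOrdinal)) _).trans ?_
  rw [Cardinal.aleph_mul_aleph0]

/-- An uncountable tree without uncountable chains and antichains is a Suslin tree. -/
theorem IsTreeOrder.isSuslinTree (hT : IsTreeOrder T) (hu : ¬ (Set.univ : Set T).Countable)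
    (hc : ∀ C : Set T, IsChain (· ≤ ·) C → C.Countable)
    (ha : ∀ A : Set T, IsAntichain (· ≤ ·) A → A.Countable) : IsSuslinTree T := by
  have hlev : ∀ o, {t | hT.height t = o}.Countable := fun o => ha _ fun s hs t ht hne =>
    (hT.incomp_of_height_eq (hs.trans ht.symm) hne).1
  have hlt : ∀ t, hT.height t < ω_ 1 := by
    intro t
    rw [countable_iff_card_lt_omega_one, IsTreeOrder.height, Ordinal.card_type,
      Cardinal.le_aleph0_iff_set_countable]
    exact hc _ fun x hx y hy _ => hT.le_or_le (le_of_lt hx) (le_of_lt hy)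
  refine ⟨⟨hT, ?_, hlev⟩, hc, ha⟩
  have hmem : treeLevel T hT (ω_ 1) = ∅ :=
    Set.eq_empty_iff_forall_notMem.2 fun t ht => (hlt t).ne ht
  refine le_antisymm (csInf_le' hmem) (le_csInf ⟨_, hmem⟩ fun o ho => ?_)
  by_contra! hlt'
  obtain ⟨a, rfl⟩ := OmegaOne.exists_toOrdinal hlt'
  refine hu (((OmegaOne.countable_Iio a).biUnion fun b _ => hlev b.toOrdinal).mono fun t _ => ?_)
  have hta : hT.height t < a.toOrdinal := by
    by_contra! hle
    obtain ⟨s, -, hs⟩ := hT.exists_height_eq hle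
    exact Set.eq_empty_iff_forall_notMem.1 ho s hs
  obtain ⟨b, hb⟩ := OmegaOne.exists_toOrdinal (hlt t)
  refine Set.mem_biUnion (x := b) ?_ hb.symm
  rw [← hb] at hta
  exact (Ordinal.typein_lt_typein (α := OmegaOne.{u}) (· < ·)).1 hta

theorem IsTreeOrder.isSuslinTree_subtype (hT : IsTreeOrder T) {Y : Set T} (hY : ¬ Y.Countable)
    (hc : ∀ C : Set T, IsChain (· ≤ ·) C → C.Countable)
    (ha : ∀ A ⊆ Y, IsAntichain (· ≤ ·) A → A.Countable) : IsSuslinTree {t // t ∈ Y} := by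
  have hcount : ∀ A : Set {t // t ∈ Y}, (Subtype.val '' A).Countable → A.Countable := fun A =>
    Set.countable_of_injective_of_countable_image Subtype.val_injective.injOn
  refine (hT.subtype _).isSuslinTree (fun hu => hY ?_)
    (fun C hC => hcount _ (hc _ ?_)) (fun A hA => hcount _ (ha _ ?_ ?_))
  · simpa using hu.image Subtype.val
  · rintro _ ⟨x, hx, rfl⟩ _ ⟨y, hy, rfl⟩ hne
    exact hC hx hy fun h => hne (congrArg _ h)
  · rintro _ ⟨x, -, rfl⟩
    exact x.2
  · rintro _ ⟨x, hx, rfl⟩ _ ⟨y, hy, rfl⟩ hne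
    exact hA hx hy fun h => hne (congrArg _ h)

theorem IsSuslinTree.subtype (h : IsSuslinTree T) {Y : Set T} (hY : ¬ Y.Countable) :
    IsSuslinTree {t // t ∈ Y} :=
  h.1.choose.isSuslinTree_subtype hY h.2.1 fun A _ => h.2.2 A

/-- If there are no Suslin trees, then every uncountable subset of an Aronszajn tree has an
uncountable antichain. -/
theorem IsAronszajnTree.exists_antichain (h : IsAronszajnTree T)
    (hno : ¬ ∃ (T : Type u) (_ : PartialOrder T), IsSuslinTree T) {Y : Set T}
    (hY : ¬ Y.Countable) : ∃ A ⊆ Y, ¬ A.Countable ∧ IsAntichain (· ≤ ·) A := by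
  by_contra! hA
  exact hno ⟨{t // t ∈ Y}, inferInstance, h.1.choose.isSuslinTree_subtype hY h.2
    fun A hAY hanti => by_contra fun hn => hA A hAY hn hanti⟩

theorem IsSuslinTree.not_isSpecialTree (h : IsSuslinTree T) : ¬ IsSpecialTree T := by
  rintro ⟨f, hf⟩
  refine h.1.not_countable ((Set.countable_iUnion fun n => h.2.2 _ (hf n)).mono fun t _ => ?_)
  exact Set.mem_iUnion.2 ⟨f t, rfl⟩

theorem exists_maximal_antichain (Y : Set T) :
    ∃ W ⊆ Y, IsAntichain (· ≤ ·) W ∧ ∀ y ∈ Y, ∃ w ∈ W, w ≤ y ∨ y ≤ w := by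
  obtain ⟨W, hW⟩ := zorn_subset {W : Set T | W ⊆ Y ∧ IsAntichain (· ≤ ·) W} (by
    intro c hc hchain
    refine ⟨⋃₀ c, ⟨Set.sUnion_subset fun s hs => (hc hs).1, ?_⟩,
      fun s => Set.subset_sUnion_of_mem⟩
    rintro x ⟨s, hs, hx⟩ y ⟨s', hs', hy⟩ hne
    rcases hchain.total hs hs' with hle | hle
    exacts [(hc hs').2 (hle hx) hy hne, (hc hs).2 hx (hle hy) hne])
  refine ⟨W, hW.prop.1, hW.prop.2, fun y hy => ?_⟩
  by_contra! hinc
  have hins : insert y W ⊆ W := hW.le_of_ge ⟨Set.insert_subset hy hW.prop.1,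
    hW.prop.2.insert (fun w hw _ => (hinc w hw).1) (fun w hw _ => (hinc w hw).2)⟩
    (Set.subset_insert y W)
  exact (hinc y (hins (Set.mem_insert y W))).1 le_rfl

/-- A family of nodes of a Suslin tree that is indexed by an uncountable set and has countable
fibers has uncountably many members above every extension of some fixed node. -/
theorem IsSuslinTree.exists_forall_not_countable (h : IsSuslinTree T) {ι : Type v} {X : Set ι}
    (hX : ¬ X.Countable) (p : ι → T) (hp : ∀ t, {i ∈ X | p i = t}.Countable) :
    ∃ t, ∀ s, t ≤ s → ¬ {i ∈ X | s ≤ p i}.Countable := by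
  obtain ⟨hT, hlt, hlev, hini, -⟩ := h.1.exists_height
  by_contra! hsmall
  -- `W` is countable, and each `p i` is comparable with some `w ∈ W`. Countably many `i` have `p i`
  -- above a given `w` by smallness; the others have `p i` in the countable set of nodes below `W`,
  -- where fibers are countable.
  obtain ⟨W, hWs, hWa, hW⟩ := exists_maximal_antichain {w : T | {i ∈ X | w ≤ p i}.Countable}
  have hWc : W.Countable := h.2.2 W hWa
  have hdown : ∀ w : T, (Set.Iic w).Countable := fun w => h.2.1 _ fun x hx y hy _ =>
    hT.le_or_le hx hy
  refine hX (((hWc.biUnion fun w hw => hWs hw).union ((hWc.biUnion fun w _ => hdown w).biUnion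
    fun t _ => hp t)).mono fun i hi => ?_)
  obtain ⟨s, hs, hsc⟩ := hsmall (p i)
  obtain ⟨w, hw, hws⟩ := hW s hsc
  have hwp : w ≤ p i ∨ p i ≤ w := hws.elim (fun hws => hT.le_or_le hws hs) fun hws =>
    Or.inr (hs.trans hws)
  rcases hwp with hwp | hwp
  · exact Or.inl (Set.mem_biUnion hw ⟨hi, hwp⟩)
  · exact Or.inr (Set.mem_biUnion (Set.mem_biUnion hw hwp) ⟨hi, rfl⟩)

end

/-! ### The specializing forcing -/

/-- The forcing that specializes a tree: finite sets of pairs `(t, n)` such that nodes with the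
same number `n` are not strictly comparable. -/
def SpecializingPoset (T : Type u) [PartialOrder T] : Type u :=
  {p : Finset (T × ℕ) // ∀ x ∈ p, ∀ y ∈ p, x.2 = y.2 → ¬ x.1 < y.1}

instance (T : Type u) [PartialOrder T] : Preorder (SpecializingPoset T) where
  le p q := q.1 ⊆ p.1
  le_refl p := Finset.Subset.refl p.1
  le_trans _ _ _ hpq hqr := Finset.Subset.trans hqr hpq

instance (T : Type u) [PartialOrder T] : Nonempty (SpecializingPoset T) :=
  ⟨⟨∅, by simp⟩⟩

/-- Whenever `ω₁` many finite tuples of nodes are attached to finite subsets of `ω₁`, injectively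
in each coordinate, there is a captured pair for which the corresponding coordinates are
incomparable. -/
def CapturesIncomparable (T : Type u) [PartialOrder T] (τ : SchemeType)
    (F : Set (Finset OmegaOne.{u})) : Prop :=
  ∀ (κ : Type) [Finite κ] (s : κ → OmegaOne.{u} → T) (D : OmegaOne.{u} → FinOmegaOne.{u}),
    (∀ c, Function.Injective (s c)) → Function.Injective D → ∀ k : ℕ,
      ∃ l, k ≤ l ∧ ∃ a : Fin 2 → OmegaOne.{u},
        IsCapturedAt τ F (fun i => (D (a i) : Finset OmegaOne.{u})) l ∧
        ∀ c, TreeIncomp (s c (a 0)) (s c (a 1))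

section

variable {T : Type u} [PartialOrder T] {τ : SchemeType} {F : Set (Finset OmegaOne.{u})}

theorem SpecializingPoset.exists_le_of_forall {D : Fin 2 → SpecializingPoset T}
    (h : ∀ x ∈ (D 0).1, ∀ y ∈ (D 1).1, x.2 = y.2 → ¬ x.1 < y.1 ∧ ¬ y.1 < x.1) :
    ∃ r, ∀ i, r ≤ D i := by
  classical
  refine ⟨⟨(D 0).1 ∪ (D 1).1, ?_⟩, ?_⟩
  · intro x hx y hy hxy
    rcases Finset.mem_union.1 hx with hx | hx <;> rcases Finset.mem_union.1 hy with hy | hy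
    exacts [(D 0).2 x hx y hy hxy, (h x hx y hy hxy).1, (h y hy x hx hxy.symm).2,
      (D 1).2 x hx y hy hxy]
  · intro i
    fin_cases i
    exacts [Finset.subset_union_left, Finset.subset_union_right]

/-- An uncountable family of conditions of the specializing forcing can be thinned out so that
the conditions are enumerated uniformly by finitely many coordinates, each of which is constant
or has countable fibers. -/
theorem SpecializingPoset.exists_enumeration {ι : Type v} {X : Set ι} (hX : ¬ X.Countable)
    (p : ι → SpecializingPoset T) :
    ∃ Y ⊆ X, ¬ Y.Countable ∧ ∃ (N : ℕ) (t : Fin N → ι → T) (v : Fin N → ℕ),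
      (∀ i ∈ Y, ∀ x, x ∈ (p i).1 ↔ ∃ a, x = (t a i, v a)) ∧
      (∀ a, (∃ c, ∀ i ∈ Y, t a i = c) ∨ ∀ c, {i ∈ Y | t a i = c}.Countable) ∧
      ∀ a b, (∃ s s', TreeIncomp s s' ∧ ∀ i ∈ Y, s ≤ t a i ∧ s' ≤ t b i) ∨
        ∀ s s', TreeIncomp s s' → {i ∈ Y | s ≤ t a i ∧ s' ≤ t b i}.Countable := by
  classical
  obtain ⟨N, hN⟩ := exists_uncountable_fiber hX fun i => (p i).1.card
  set X₁ := {i ∈ X | (p i).1.card = N}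
  obtain ⟨i₀, hi₀⟩ : X₁.Nonempty := by
    rw [Set.nonempty_iff_ne_empty]
    rintro h
    exact hN (h ▸ Set.countable_empty)
  have hx : ∀ i ∈ X₁, ∃ x : Fin N → T × ℕ, ∀ z, z ∈ (p i).1 ↔ ∃ a, z = x a := by
    intro i hi
    let e := Finset.equivFinOfCardEq hi.2
    refine ⟨fun a => (e.symm a).1, fun z => ⟨fun hz => ⟨e ⟨z, hz⟩, by simp⟩, ?_⟩⟩
    rintro ⟨a, rfl⟩
    exact (e.symm a).2
  -- Outside `X₁` the enumeration of `p i₀` serves as a default value, since `T` is not known to be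
  -- inhabited.
  have hx' : ∀ i, ∃ x : Fin N → T × ℕ, i ∈ X₁ → ∀ z, z ∈ (p i).1 ↔ ∃ a, z = x a := by
    intro i
    by_cases hi : i ∈ X₁
    · obtain ⟨x, h⟩ := hx i hi
      exact ⟨x, fun _ => h⟩
    · obtain ⟨x, -⟩ := hx i₀ hi₀
      exact ⟨x, fun h => absurd h hi⟩
  choose x hx using hx'
  obtain ⟨v, hv⟩ := exists_uncountable_fiber hN fun i => fun a => (x i a).2
  set X₂ := {i ∈ X₁ | (fun a => (x i a).2) = v}
  obtain ⟨X₃, h32, h3, hconst⟩ := exists_uncountable_subset_forall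
    (fun (a : Fin N) Y => (∃ c, ∀ i ∈ Y, (x i a).1 = c) ∨ ∀ c, {i ∈ Y | (x i a).1 = c}.Countable)
    (fun a X Y hYX h => h.imp (fun ⟨c, hc⟩ => ⟨c, fun i hi => hc i (hYX hi)⟩)
      fun hc c => (hc c).mono (by rintro i ⟨hi, h⟩; exact ⟨hYX hi, h⟩))
    (fun a X hX => by
      by_cases h : ∃ c, ¬ {i ∈ X | (x i a).1 = c}.Countable
      · obtain ⟨c, hc⟩ := h
        exact ⟨{i ∈ X | (x i a).1 = c}, fun i hi => hi.1, hc, Or.inl ⟨c, fun i hi => hi.2⟩⟩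
      · push Not at h
        exact ⟨X, subset_rfl, hX, Or.inr h⟩) hv
  obtain ⟨X₄, h43, h4, hsep⟩ := exists_uncountable_subset_forall
    (fun (c : Fin N × Fin N) Y =>
      (∃ s s', TreeIncomp s s' ∧ ∀ i ∈ Y, s ≤ (x i c.1).1 ∧ s' ≤ (x i c.2).1) ∨
        ∀ s s', TreeIncomp s s' → {i ∈ Y | s ≤ (x i c.1).1 ∧ s' ≤ (x i c.2).1}.Countable)
    (fun c X Y hYX h => h.imp
      (fun ⟨s, s', hs, h⟩ => ⟨s, s', hs, fun i hi => h i (hYX hi)⟩)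
      fun h s s' hs => (h s s' hs).mono (by rintro i ⟨hi, h⟩; exact ⟨hYX hi, h⟩))
    (fun c X hX => by
      by_cases h : ∃ s s', TreeIncomp s s' ∧
        ¬ {i ∈ X | s ≤ (x i c.1).1 ∧ s' ≤ (x i c.2).1}.Countable
      · obtain ⟨s, s', hs, h⟩ := h
        exact ⟨{i ∈ X | s ≤ (x i c.1).1 ∧ s' ≤ (x i c.2).1}, fun i hi => hi.1, h,
          Or.inl ⟨s, s', hs, fun i hi => hi.2⟩⟩
      · push Not at h
        exact ⟨X, subset_rfl, hX, Or.inr h⟩) h3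
  refine ⟨X₄, fun i hi => (h32 (h43 hi)).1.1, h4, N, fun a i => (x i a).1, v, ?_, ?_, ?_⟩
  · intro i hi z
    rw [hx i (h32 (h43 hi)).1 z]
    refine exists_congr fun a => ?_
    rw [← congrFun (h32 (h43 hi)).2 a]
  · exact fun a => (hconst a).imp (fun ⟨c, hc⟩ => ⟨c, fun i hi => hc i (h43 hi)⟩)
      fun hc c => (hc c).mono (by rintro i ⟨hi, h⟩; exact ⟨h43 hi, h⟩)
  · exact fun a b => hsep (a, b)

/-- On all but countably many indices, tuples of nodes can be restricted to a fixed level, and the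
restrictions of two coordinates that are never separated agree. -/
theorem IsOmegaOneTree.countable_not_exists_restriction (h : IsOmegaOneTree T)
    (hT : IsTreeOrder T) {ι : Type v} {Y : Set ι} {κ : Type} [Finite κ] (t : κ → ι → T)
    (ht : ∀ a c, {i ∈ Y | t a i = c}.Countable) {o : Ordinal.{u}} (ho : o < ω_ 1) :
    (Y \ {i | ∃ s : κ → T, (∀ a, s a ≤ t a i ∧ hT.height (s a) = o) ∧
      ∀ a b, (∀ s s', TreeIncomp s s' → {i ∈ Y | s ≤ t a i ∧ s' ≤ t b i}.Countable) →
        s a = s b}).Countable := by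
  obtain ⟨hT', -, hlev, hini, -⟩ := h.exists_height
  -- The exceptional indices are of two kinds: some coordinate has height below `o`, or two
  -- never-separated coordinates restrict to different nodes of level `o`. Distinct nodes of one
  -- level are incomparable, so each such pair of nodes accounts for only countably many indices.
  have hlow : (⋃ a, ⋃ c ∈ {c | hT.height c < o}, {i ∈ Y | t a i = c}).Countable :=
    Set.countable_iUnion fun a => (hini o ho).biUnion fun c _ => ht a c
  have hdiff : (⋃ a, ⋃ b, ⋃ s ∈ {s | hT.height s = o}, ⋃ s' ∈ {s | hT.height s = o},
      {i ∈ Y | s ≠ s' ∧ (∀ s s', TreeIncomp s s' → {i ∈ Y | s ≤ t a i ∧ s' ≤ t b i}.Countable) ∧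
        s ≤ t a i ∧ s' ≤ t b i}).Countable := by
    refine Set.countable_iUnion fun a => Set.countable_iUnion fun b => (hlev o).biUnion fun s hs =>
      (hlev o).biUnion fun s' hs' => ?_
    by_cases hne : s ≠ s' ∧
      ∀ s s', TreeIncomp s s' → {i ∈ Y | s ≤ t a i ∧ s' ≤ t b i}.Countable
    · refine (hne.2 s s' (hT.incomp_of_height_eq (Eq.trans hs (Eq.symm hs')) hne.1)).mono ?_
      exact fun i hi => ⟨hi.1, hi.2.2.2⟩
    · exact Set.countable_empty.mono fun i hi => hne ⟨hi.2.1, hi.2.2.1⟩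
  refine (hlow.union hdiff).mono ?_
  rintro i ⟨hi, hno⟩
  by_cases hl : ∃ a, hT.height (t a i) < o
  · obtain ⟨a, ha⟩ := hl
    exact Or.inl (Set.mem_iUnion.2 ⟨a, Set.mem_biUnion (x := t a i) ha ⟨hi, rfl⟩⟩)
  push Not at hl
  choose s hs using fun a => hT.exists_height_eq (hl a)
  have hn : ∃ a b, (∀ s s', TreeIncomp s s' → {i ∈ Y | s ≤ t a i ∧ s' ≤ t b i}.Countable) ∧
      s a ≠ s b := by
    by_contra! hn
    exact hno ⟨s, hs, hn⟩
  obtain ⟨a, b, hab, hne⟩ := hn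
  exact Or.inr (Set.mem_iUnion.2 ⟨a, Set.mem_iUnion.2 ⟨b, Set.mem_biUnion (hs a).2
    (Set.mem_biUnion (hs b).2 ⟨hi, hne, hab, (hs a).1, (hs b).1⟩)⟩⟩)

/-- The hypothesis compares equal coordinates only, whereas compatibility also concerns different
coordinates `c`, `d`. If fixed incomparable nodes separate `c` from `d`, nothing is needed;
otherwise both restrict to the same node, and equal coordinates suffice. -/
theorem CapturesIncomparable.capturesCompatible (h : IsOmegaOneTree T)
    (hinc : CapturesIncomparable T τ F) : CapturesCompatible (SpecializingPoset T) τ F := by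
  intro X hX p k
  obtain ⟨hT, -⟩ := h.exists_height
  obtain ⟨Y, hYX, hY, N, t, v, hp, hconst, hsep⟩ :=
    SpecializingPoset.exists_enumeration hX p
  let κ := {a : Fin N // ∀ c, {i ∈ Y | t a i = c}.Countable}
  have hG := fun a : OmegaOne.{u} => h.countable_not_exists_restriction hT
    (fun c : κ => t c) (fun c => c.2) a.toOrdinal_lt
  -- The restrictions chosen at `a` have height `a`, so each coordinate is injective in `a`.
  obtain ⟨D, hD, hDinj⟩ := OmegaOne.exists_choice (κ := Unit) (fun _ => id)
    (fun a : OmegaOne.{u} => {i ∈ Y | ∃ s : κ → T,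
      (∀ c, s c ≤ t c i ∧ hT.height (s c) = a.toOrdinal) ∧
      ∀ c d : κ, (∀ s s', TreeIncomp s s' → {i ∈ Y | s ≤ t c i ∧ s' ≤ t d i}.Countable) →
        s c = s d})
    (fun a C hC => by
      by_contra! hn
      exact not_countable_diff hY (hG a) ((hC ()).mono fun i hi => (hn i hi).elim fun _ => id))
  choose hDY s hs hsrel using hD
  obtain ⟨l, hl, a, hcap, hsa⟩ := hinc κ (fun c b => s b c) D
    (fun c b b' hb => OmegaOne.toOrdinal_injective (by
      rw [← (hs b c).2, ← (hs b' c).2]; exact congrArg _ hb)) (hDinj ()) k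
  refine ⟨l, hl, fun i => D (a i), hcap, fun i => hYX (hDY _), ?_⟩
  refine SpecializingPoset.exists_le_of_forall fun x hx y hy hxy => ?_
  obtain ⟨c, rfl⟩ := (hp _ (hDY _) x).1 hx
  obtain ⟨d, rfl⟩ := (hp _ (hDY _) y).1 hy
  have hmem := fun i => (hp _ (hDY (a i)))
  have hne : ∀ i, ¬ t c (D (a i)) < t d (D (a i)) ∧ ¬ t d (D (a i)) < t c (D (a i)) := fun i =>
    ⟨(p _).2 _ ((hmem i _).2 ⟨c, rfl⟩) _ ((hmem i _).2 ⟨d, rfl⟩) hxy,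
      (p _).2 _ ((hmem i _).2 ⟨d, rfl⟩) _ ((hmem i _).2 ⟨c, rfl⟩) hxy.symm⟩
  -- In the second case both nodes already occur in the single condition attached to `D (a i)`; this
  -- covers constant coordinates.
  suffices hS : TreeIncomp (t c (D (a 0))) (t d (D (a 1))) ∨
      ∃ i, t c (D (a 0)) = t c (D (a i)) ∧ t d (D (a 1)) = t d (D (a i)) by
    rcases hS with hS | ⟨i, h0, h1⟩
    · exact ⟨fun hlt => hS.1 hlt.le, fun hlt => hS.2 hlt.le⟩
    · show ¬ t c (D (a 0)) < t d (D (a 1)) ∧ ¬ t d (D (a 1)) < t c (D (a 0))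
      rw [h0, h1]
      exact hne i
  rcases hconst c with ⟨z, hz⟩ | hc
  · exact Or.inr ⟨1, (hz _ (hDY _)).trans (hz _ (hDY _)).symm, rfl⟩
  rcases hconst d with ⟨z, hz⟩ | hd
  · exact Or.inr ⟨0, rfl, (hz _ (hDY _)).trans (hz _ (hDY _)).symm⟩
  left
  rcases hsep c d with ⟨z, z', hzz, hle⟩ | hrel
  · exact hT.incomp_mono hzz (hle _ (hDY _)).1 (hle _ (hDY _)).2
  · refine hT.incomp_mono (hsa ⟨c, hc⟩) (hs _ ⟨c, hc⟩).1 ?_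
    rw [hsrel (a 1) ⟨c, hc⟩ ⟨d, hd⟩ hrel]
    exact (hs _ ⟨d, hd⟩).1

theorem CapturesIncomparable.isSpecialTree (h : IsOmegaOneTree T)
    (hinc : CapturesIncomparable T τ F) (hcap : IsCapturing τ F 2)
    (hm : ((ℵ_ 1 : Cardinal.{u}) : WithTop Cardinal.{u}) < schemeMartinNumber τ F 2) :
    IsSpecialTree T := by
  classical
  obtain ⟨G, hG⟩ := (hinc.capturesCompatible h).exists_filter hcap hm h.mk_le
    (fun t => {p | ∃ n, (t, n) ∈ p.1}) (by
      intro t p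
      -- A number not yet used can be given to `t` without creating a conflict.
      obtain ⟨n, hn⟩ := Infinite.exists_notMem_finset (p.1.image Prod.snd)
      have hn' : ∀ x ∈ p.1, x.2 ≠ n := fun x hx he => hn (Finset.mem_image.2 ⟨x, hx, he⟩)
      refine ⟨⟨insert (t, n) p.1, fun x hx y hy hxy => ?_⟩, ⟨n, Finset.mem_insert_self _ _⟩,
        Finset.subset_insert _ _⟩
      rcases Finset.mem_insert.1 hx with rfl | hx <;> rcases Finset.mem_insert.1 hy with rfl | hy
      exacts [lt_irrefl _, absurd hxy.symm (hn' y hy), absurd hxy (hn' x hx), p.2 x hx y hy hxy])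
  choose p hpG f hf using hG
  refine ⟨f, fun n s hs t ht hne hle => ?_⟩
  obtain ⟨q, -, hqs, hqt⟩ := G.directed _ (hpG s) _ (hpG t)
  refine q.2 _ (hqs (hf s)) _ (hqt (hf t)) ?_ (lt_of_le_of_ne hle hne)
  exact Eq.trans hs (Eq.symm ht)

end

/-! ### Aronszajn and Suslin trees -/

section

variable {T : Type u} [PartialOrder T] {τ : SchemeType} {F : Set (Finset OmegaOne.{u})}

theorem IsAronszajnTree.capturesIncomparable (h : IsAronszajnTree T)
    (hno : ¬ ∃ (T : Type u) (_ : PartialOrder T), IsSuslinTree T) (hcap : IsCapturing τ F 2) :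
    CapturesIncomparable T τ F := by
  intro κ _ s D hs hD k
  obtain ⟨Y, -, hY, hanti⟩ := exists_uncountable_subset_forall
    (fun (c : κ) Y => IsAntichain (· ≤ ·) (s c '' Y))
    (fun c X Y hYX hX => hX.subset (Set.image_mono hYX))
    (fun c X hX => by
      obtain ⟨A, hAX, hA, hanti⟩ := h.exists_antichain hno (Y := s c '' X) fun hc =>
        hX (Set.countable_of_injective_of_countable_image (hs c).injOn hc)
      refine ⟨X ∩ s c ⁻¹' A, Set.inter_subset_left, fun hc => hA ?_, hanti.subset ?_⟩
      · refine (hc.image (s c)).mono fun x hx => ?_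
        obtain ⟨a, ha, rfl⟩ := hAX hx
        exact ⟨a, ⟨ha, hx⟩, rfl⟩
      · rintro _ ⟨a, ha, rfl⟩
        exact ha.2) OmegaOne.not_countable_univ
  obtain ⟨l, hl, a, haY, ha⟩ := hcap.exists_forall hY (fun _ : Unit => D)
    (fun _ => hD.injOn) k
  have hne : a 0 ≠ a 1 := fun he =>
    absurd ((ha ()).1 (congrArg (fun b => (D b).1) he)) (by decide)
  exact ⟨l, hl, a, ha (), fun c =>
    ⟨hanti c ⟨_, haY 0, rfl⟩ ⟨_, haY 1, rfl⟩ fun he => hne (hs c he),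
      hanti c ⟨_, haY 1, rfl⟩ ⟨_, haY 0, rfl⟩ fun he => hne (hs c he).symm⟩⟩

/-- Forcing with a Suslin tree adds an uncountable chain. -/
theorem IsSuslinTree.not_capturesCompatible (h : IsSuslinTree T)
    (hT : ∀ t : T, ¬ (Set.Ici t).Countable) (hcap : IsCapturing τ F 2)
    (hm : ((ℵ_ 1 : Cardinal.{u}) : WithTop Cardinal.{u}) < schemeMartinNumber τ F 2) :
    ¬ CapturesCompatible Tᵒᵈ τ F := by
  intro hcomp
  obtain ⟨hTr, hlt, -, hini, -⟩ := h.1.exists_height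
  obtain ⟨t⟩ : Nonempty T := by
    by_contra hemp
    exact h.1.not_countable (Set.univ_eq_empty_iff.2 (not_nonempty_iff.1 hemp) ▸
      Set.countable_empty)
  have : Nonempty Tᵒᵈ := ⟨OrderDual.toDual t⟩
  obtain ⟨G, hG⟩ := hcomp.exists_filter hcap hm OmegaOne.mk_eq.le
    (fun a => {x | a.toOrdinal ≤ hTr.height (OrderDual.ofDual x)}) (by
      intro a p
      by_contra! hp
      -- Only countably many nodes have height below `a`, so an uncountable cone reaches height `a`.
      refine hT (OrderDual.ofDual p) ((hini _ a.toOrdinal_lt).mono fun x hx => ?_)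
      by_contra hax
      exact hp (OrderDual.toDual x) (show a.toOrdinal ≤ hTr.height x from not_lt.1 hax) hx)
  choose x hxG hx using hG
  have hchain : IsChain (· ≤ ·) {t : T | OrderDual.toDual t ∈ G} := by
    intro y hy z hz _
    obtain ⟨u, -, hyu, hzu⟩ := G.directed _ hy _ hz
    exact hTr.le_or_le (u := OrderDual.ofDual u) hyu hzu
  have := (h.2.1 _ hchain).to_subtype
  -- If the chain were countable, one node `c` would serve uncountably many `a`, all bounded by its
  -- countable height.
  obtain ⟨c, hc⟩ := exists_uncountable_fiber OmegaOne.not_countable_univ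
    fun a => (⟨OrderDual.ofDual (x a), hxG a⟩ : {t : T | OrderDual.toDual t ∈ G})
  obtain ⟨b, hb⟩ := OmegaOne.exists_toOrdinal (hlt c.1)
  refine hc (((OmegaOne.countable_Iio b).insert b).mono ?_)
  rintro a ⟨-, rfl⟩
  have hab : a.toOrdinal ≤ b.toOrdinal := hb ▸ hx a
  rcases hab.eq_or_lt with he | hlt'
  · exact Or.inl (OmegaOne.toOrdinal_injective he)
  · exact Or.inr ((Ordinal.typein_lt_typein (α := OmegaOne.{u}) (· < ·)).1 hlt')

/-- Almost all nodes above a node of a Suslin tree lie above members of a family that is dense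
above that node. -/
theorem IsSuslinTree.countable_not_exists_le (h : IsSuslinTree T) {t : T} {A : Set T}
    (hA : ∀ s, t ≤ s → ∃ u ∈ A, s ≤ u) : {s | t ≤ s ∧ ¬ ∃ u ∈ A, u ≤ s}.Countable := by
  have hT := h.1.choose
  -- An exceptional node must lie below a member of the countable antichain `W`.
  obtain ⟨W, hWA, hW, hmax⟩ := exists_maximal_antichain A
  refine ((h.2.2 W hW).biUnion fun w _ => h.2.1 (Set.Iic w)
    fun x hx y hy _ => hT.le_or_le hx hy).mono ?_
  rintro s ⟨hts, hs⟩
  obtain ⟨u, hu, hsu⟩ := hA s hts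
  obtain ⟨w, hw, hwu⟩ := hmax u hu
  refine Set.mem_biUnion hw ?_
  have hws : w ≤ s ∨ s ≤ w := hwu.elim (fun hwu => hT.le_or_le hwu hsu) fun huw =>
    Or.inr (hsu.trans huw)
  exact hws.resolve_left fun hws => hs ⟨w, hWA hw, hws⟩

/-- If forcing with a Suslin tree might not preserve `2`-capturing, then captured tuples of nodes
can be separated above some node. -/
theorem IsSuslinTree.exists_capturesIncomparable (h : IsSuslinTree T) (hcap : IsCapturing τ F 2)
    (hT : ¬ CapturesCompatible Tᵒᵈ τ F) :
    ∃ t : T, IsSuslinTree {s // s ∈ Set.Ici t} ∧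
      CapturesIncomparable {s // s ∈ Set.Ici t} τ F := by
  have hTr := h.1.choose
  simp only [CapturesCompatible] at hT
  push Not at hT
  obtain ⟨X, hX, p', k, hbad⟩ := hT
  let p : FinOmegaOne.{u} → T := fun E => OrderDual.ofDual (p' E)
  have hincomp : ∀ l, k ≤ l → ∀ E : Fin 2 → FinOmegaOne.{u},
      IsCapturedAt τ F (fun i => (E i : Finset OmegaOne.{u})) l → (∀ i, E i ∈ X) →
      ¬ ∃ r : T, ∀ i, p (E i) ≤ r := by
    rintro l hl E hE hEX ⟨r, hr⟩
    obtain ⟨i, hi⟩ := hbad l hl E hE hEX (OrderDual.toDual r)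
    exact hi (hr i)
  have hfib : ∀ t, {E ∈ X | p E = t}.Countable := by
    intro t
    by_contra hn
    -- On an uncountable fiber, a captured pair would carry equal, hence compatible, conditions.
    obtain ⟨l, hl, E, hE, hEX⟩ := hcap _ hn k
    exact hincomp l hl E hE (fun i => (hEX i).1) ⟨t, fun i => (hEX i).2.le⟩
  obtain ⟨t, ht⟩ := h.exists_forall_not_countable hX p hfib
  have hdense : ∀ C : Set FinOmegaOne.{u}, C.Countable →
      {s | t ≤ s ∧ ¬ ∃ u ∈ p '' (X \ C), u ≤ s}.Countable := fun C hC =>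
    h.countable_not_exists_le fun s hs => by
      by_contra! hn
      refine ht s hs (hC.mono fun E hE => ?_)
      by_contra hEC
      exact hn (p E) ⟨E, ⟨hE.1, hEC⟩, rfl⟩ hE.2
  refine ⟨t, h.subtype fun hc => ht t le_rfl ?_, ?_⟩
  · refine (hc.biUnion fun u _ => hfib u).mono fun E hE => ?_
    exact Set.mem_biUnion (x := p E) hE.2 ⟨hE.1, rfl⟩
  intro κ _ s D hs hD k'
  -- The coordinate `none` carries the prescribed set `D`, the others the sets `E` with `p E` below
  -- the nodes. All of them must be injective for joint capturing.
  let f : Option κ → OmegaOne.{u} × (κ → FinOmegaOne.{u}) → FinOmegaOne.{u} := fun o z =>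
    o.elim (D z.1) z.2
  obtain ⟨z, hz, hinj⟩ := OmegaOne.exists_choice f
    (fun _ : OmegaOne.{u} => {z | ∀ c, z.2 c ∈ X ∧ p (z.2 c) ≤ (s c z.1).1}) (by
      intro _ C hC
      have h1 : (D ⁻¹' C none ∪ ⋃ c, (fun a => (s c a).1) ⁻¹'
          {u | t ≤ u ∧ ¬ ∃ v ∈ p '' (X \ C (some c)), v ≤ u}).Countable :=
        ((hC none).preimage hD).union (Set.countable_iUnion fun c =>
          (hdense _ (hC (some c))).preimage (Subtype.val_injective.comp (hs c)))
      obtain ⟨a, -, ha⟩ := Set.not_subset.1 fun hs => OmegaOne.not_countable_univ (h1.mono hs)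
      simp only [Set.mem_union, not_or, Set.mem_iUnion, not_exists] at ha
      have hE : ∀ c, ∃ E ∈ X \ C (some c), p E ≤ (s c a).1 := by
        intro c
        by_contra hn
        exact ha.2 c ⟨(s c a).2, by
          rintro _ ⟨⟨E, hEX, rfl⟩, hE⟩
          exact hn ⟨E, hEX, hE⟩⟩
      choose E hEX hE using hE
      refine ⟨(a, E), fun c => ⟨(hEX c).1, hE c⟩, fun o => ?_⟩
      cases o with
      | none => exact ha.1
      | some c => exact (hEX c).2)
  -- The level must exceed `k` for incompatibility to apply and `k'` for the conclusion.
  obtain ⟨l, hl, i, -, hi⟩ := hcap.exists_forall OmegaOne.not_countable_univ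
    (fun o a => f o (z a)) (fun o => (hinj o).injOn) (max k k')
  refine ⟨l, (le_max_right _ _).trans hl, fun e => (z (i e)).1, hi none, fun c => ?_⟩
  have hno := hincomp l ((le_max_left _ _).trans hl) (fun e => (z (i e)).2 c) (hi (some c))
    fun e => (hz _ c).1
  refine hTr.incomp_mono (s := p ((z (i 0)).2 c)) (t := p ((z (i 1)).2 c)) ⟨?_, ?_⟩
    (hz _ c).2 (hz _ c).2
  · exact fun hle => hno ⟨_, Fin.forall_fin_two.2 ⟨hle, le_rfl⟩⟩
  · exact fun hle => hno ⟨_, Fin.forall_fin_two.2 ⟨le_rfl, hle⟩⟩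

theorem not_isSuslinTree (hcap : IsCapturing τ F 2)
    (hm : ((ℵ_ 1 : Cardinal.{u}) : WithTop Cardinal.{u}) < schemeMartinNumber τ F 2) :
    ¬ IsSuslinTree T := by
  intro h
  -- Pruning: with the identity family, every node above `t` has an uncountable cone.
  obtain ⟨t, ht⟩ := h.exists_forall_not_countable h.1.not_countable id fun t =>
    (Set.countable_singleton t).mono (by rintro s ⟨-, hs⟩; exact hs)
  have hIci : ∀ s, t ≤ s → ¬ (Set.Ici s).Countable := fun s hs hc =>
    ht s hs (hc.mono (by rintro x ⟨-, hx⟩; exact hx))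
  have h' := h.subtype (hIci t le_rfl)
  obtain ⟨s, hs, hinc⟩ := h'.exists_capturesIncomparable hcap
    (h'.not_capturesCompatible (fun s hc => hIci s.1 s.2 ((hc.image Subtype.val).mono
      (by intro x hx; exact ⟨⟨x, le_trans s.2 hx⟩, hx, rfl⟩))) hcap hm)
  exact hs.not_isSpecialTree (hinc.isSpecialTree hs.1 hcap hm)

end

end

theorem mainTheorem7 (τ : SchemeType) (hτ : τ.IsGood) (F : Set (Finset OmegaOne.{u}))
    (hF : IsConstructionScheme τ F) (hcap : IsCapturing τ F 2)
    (hm : ((ℵ_ 1 : Cardinal.{u}) : WithTop Cardinal.{u}) < schemeMartinNumber τ F 2) :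
    (¬ ∃ (T : Type u) (_ : PartialOrder T), IsSuslinTree T) ∧
      (∀ (T : Type u) [PartialOrder T], IsAronszajnTree T → IsSpecialTree T) := by
  have hno : ¬ ∃ (T : Type u) (_ : PartialOrder T), IsSuslinTree T := fun ⟨_, _, h⟩ =>
    not_isSuslinTree hcap hm h
  exact ⟨hno, fun T _ h => (h.capturesIncomparable hno hcap).isSpecialTree h.1 hcap hm⟩
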